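/- Let $R$ be a $d\times d$ integer matrix all of whose complex eigenvalues have modulus $>1$, let $\mathcal A\subset\mathbb Z^d$ be a finite set with $0\in\mathcal A$ and $\#\mathcal A\ge 2$, and let $(\rho_a)_{a\in\mathcal A}$ be probability weights, i.e. $0<\rho_a<1$ and $\sum_{a\in\mathcal A}\rho_a=1$. Let $\mu$ be the invariant measure of the affine iterated function system $\tau_a(x)=R^{-1}(x+a)$ $(x\in\mathbb R^d,\ a\in\mathcal A)$ with these weights, i.e. the Borel probability measure on $\mathbb R^d$ satisfying $\mu=\sum_{a\in\mathcal A}\rho_a\,(\mu\circ\tau_a^{-1})$. Then there is a countably infinite set $\Lambda\subset\mathbb R^d$ such that, for every $p\in[1,2]$ with conjugate exponent $q$ $\left(\tfrac1p+\tfrac1q=1\right)$, the measure $\nu=\sum_{\lambda\in\Lambda}\delta_\lambda$ is a $(p,q)$-Bessel measure for $\mu$. Here $e_t(x)=e^{2\pi i t\cdot x}$ and $\widehat{f\,d\mu}(t)=\int f(x)e^{-2\pi i t\cdot x}\,d\mu(x)$, and $L^p(\mu)$ carries the semi-inner product $$[f,g]_{L^p(\mu)}=\frac{1}{\|g\|_{L^p(\mu)}^{p-2}}\int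 f\,|g|^{p-1}\,\overline{\operatorname{sgn}(g)}\,d\mu\quad(\|g\|_{L^p(\mu)}\ne0),$$ and $[f,g]_{L^p(\mu)}=0$ if $\|g\|_{L^p(\mu)}=0$, where $\operatorname{sgn}(z)=z/|z|$ for $z\neq 0$ and $\operatorname{sgn}(0)=0$ (so that $[f,e_t]_{L^p(\mu)}=\widehat{f\,d\mu}(t)$ for a probability measure $\mu$). A Borel measure $\nu$ on $\mathbb R^d$ is a $(p,q)$-Bessel measure for $\mu$ if there is a constant $B>0$ such that, for all $f\in L^p(\mu)$, $$\int_{\mathbb R^d}\bigl|[f,e_t]_{L^p(\mu)}\bigr|^q\,d\nu(t)\le B\,\|f\|_{L^p(\mu)}^q\quad(p\ne1),\qquad \bigl\|\widehat{f\,d\mu}\bigr\|_{L^\infty(\nu)}\le B\,\|f\|_{L^1(\mu)}\quad(p=1,\ q=\infty).$$ -/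

import Mathlib

open MeasureTheory
open scoped ENNReal

noncomputable section

namespace PQBessel

/-- The Euclidean space of dimension `d`. -/
abbrev E (d : ℕ) : Type := EuclideanSpace ℝ (Fin d)

/-- The exponential function `e_t(x) = exp(2 π i t · x)`. -/
def expo {d : ℕ} (t x : E d) : ℂ :=
  Complex.exp (2 * (Real.pi : ℂ) * Complex.I * ((inner ℝ t x : ℝ) : ℂ))

/-- The Fourier transform of the complex measure `f dμ`:
`t ↦ ∫ f(x) exp(-2 π i t · x) dμ(x)`. -/
def fourierMeasure {d : ℕ} (μ : Measure (E d)) (f : E d → ℂ) (t : E d) : ℂ :=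
  ∫ x, f x * expo (-t) x ∂μ

/-- The complex sign `z / |z|`, with value `0` at `z = 0`. -/
def sgn (z : ℂ) : ℂ := if z = 0 then 0 else z / ((‖z‖ : ℝ) : ℂ)

/-- The compatible semi-inner product on `L^p(μ)` (used for finite `p ≥ 1`):
`[f,g] = ‖g‖_p^{-(p-2)} ∫ f |g|^{p-1} conj(sgn g) dμ` if `‖g‖_p ≠ 0`,
and `[f,g] = 0` if `‖g‖_p = 0`. -/
def semiInner {d : ℕ} (p : ℝ≥0∞) (μ : Measure (E d)) (f g : E d → ℂ) : ℂ :=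
  if eLpNorm g p μ = 0 then 0
  else
    ((1 / (eLpNorm g p μ).toReal ^ (p.toReal - 2) : ℝ) : ℂ) *
      ∫ x, f x * ((‖g x‖ ^ (p.toReal - 1) : ℝ) : ℂ) * (starRingEnd ℂ) (sgn (g x)) ∂μ

/-- `ν` is a `(p,q)`-Bessel measure for `μ`; here `μ` is a finite Borel measure, `1 ≤ p < ∞`
and `q` is the exponent conjugate to `p` (so that `p = 1` exactly when `q = ∞`).
For `p = 1` the bound is on the norm of the Fourier transform of `f dμ` in `L^∞(ν)`. -/
def IsBesselMeasure {d : ℕ} (p q : ℝ≥0∞) (μ ν : Measure (E d)) : Prop :=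
  ∃ B : ℝ, 0 < B ∧ ∀ f : E d → ℂ, MemLp f p μ →
    if p = 1 then
      eLpNorm (fourierMeasure μ f) ∞ ν ≤ ENNReal.ofReal B * eLpNorm f 1 μ
    else
      ∫⁻ t, ‖semiInner p μ f (expo t)‖ₑ ^ q.toReal ∂ν
        ≤ ENNReal.ofReal B * eLpNorm f p μ ^ q.toReal

/-- The measure `∑_{t ∈ Λ} δ_t`. -/
def diracSum {d : ℕ} (Λ : Set (E d)) : Measure (E d) :=
  Measure.sum fun t : Λ => Measure.dirac (t : E d)

/-- An integer matrix is expansive if all its (complex) eigenvalues have modulus `> 1`. -/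
def IsExpansive {d : ℕ} (R : Matrix (Fin d) (Fin d) ℤ) : Prop :=
  ∀ z ∈ spectrum ℂ (R.map (fun k : ℤ => (k : ℂ))), 1 < ‖z‖

/-- The affine map `τ_a(x) = R⁻¹ (x + a)`. -/
def tau {d : ℕ} (R : Matrix (Fin d) (Fin d) ℤ) (a : Fin d → ℤ) (x : E d) : E d :=
  WithLp.toLp 2 ((R.map (fun k : ℤ => (k : ℝ)))⁻¹.mulVec (fun i => x i + (a i : ℝ)))

/-- `μ` is the invariant measure of the affine iterated function system `(τ_a)_{a ∈ A}` with
weights `(ρ_a)_{a ∈ A}`: a Borel probability measure with `μ = ∑_{a ∈ A} ρ_a (μ ∘ τ_a⁻¹)`.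
For an expansive `R` and probability weights there is exactly one such measure on the whole
space, and it is carried by the attractor. -/
def IsInvariantMeasure {d : ℕ} (R : Matrix (Fin d) (Fin d) ℤ) (A : Finset (Fin d → ℤ))
    (ρ : (Fin d → ℤ) → ℝ) (μ : Measure (E d)) : Prop :=
  IsProbabilityMeasure μ ∧ μ = ∑ a ∈ A, ENNReal.ofReal (ρ a) • μ.map (tau R a)

end PQBessel

end

/-!
Suppose that `μ` has an atom. Its atoms of maximal mass form a finite set `M`, and by invariance the
mass of such an atom `x` is a convex combination of the masses of the points `R x - a`, `a ∈ A`, so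
that these are again in `M`. Each map `x ↦ R x - a` thus permutes `M`, and comparing the sums of all
elements of `M` shows that `a` is the same for all `a ∈ A`, contradicting `2 ≤ #A`.

Since `μ` has no atoms, Wiener's lemma says that the mean of `|μ̂|²` over larger and larger parts of
the space tends to zero. The means are taken against wider and wider Gaussians. A frequency can thus
be found at which the exponential is as close to orthogonal as desired to finitely many given ones,
and an induction produces a sequence of exponentials whose Gram matrix is a small perturbation of
the identity. It is a Bessel sequence in `L²(μ)`, while its members are bounded by `1`, and
F. Riesz's theorem, proved by means of the three lines theorem, interpolates between these bounds.
-/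

namespace PQBessel

section Atoms

theorem eq_of_forall_sub_mem {V : Type*} [AddCommGroup V] [IsAddTorsionFree V] {L : V → V}
    (hL : Function.Injective L) {M : Finset V} (hM : M.Nonempty) {b c : V}
    (hb : ∀ x ∈ M, L x - b ∈ M) (hc : ∀ x ∈ M, L x - c ∈ M) : b = c := by
  classical
  have sum_eq {b : V} (hb : ∀ x ∈ M, L x - b ∈ M) : ∑ x ∈ M, (L x - b) = ∑ x ∈ M, x := by
    have hinj : Function.Injective fun x => L x - b := fun x y h => hL (sub_left_injective h)
    have himage : M.image (fun x => L x - b) = M :=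
      Finset.eq_of_subset_of_card_le (Finset.image_subset_iff.2 hb)
        (Finset.card_image_of_injective M hinj).ge
    conv_rhs => rw [← himage, Finset.sum_image hinj.injOn]
  have h := (sum_eq hb).trans (sum_eq hc).symm
  simp only [Finset.sum_sub_distrib, Finset.sum_const, sub_right_inj] at h
  exact nsmul_right_injective hM.card_ne_zero h

theorem measureReal_singleton_le_of_forall_le {V ι : Type*} [MeasurableSpace V] {μ : Measure V}
    {A : Finset ι} {w : ι → ℝ} (hw : ∀ a ∈ A, 0 < w a) (hw1 : ∑ a ∈ A, w a = 1)
    {g : ι → V} {x : V} (hμ : μ.real {x} = ∑ a ∈ A, w a * μ.real {g a})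
    (hx : ∀ y, μ.real {y} ≤ μ.real {x}) {a : ι} (ha : a ∈ A) : μ.real {x} ≤ μ.real {g a} := by
  by_contra! hlt
  refine hμ.not_gt ?_
  calc ∑ a ∈ A, w a * μ.real {g a} < ∑ a ∈ A, w a * μ.real {x} :=
        Finset.sum_lt_sum (fun i hi => mul_le_mul_of_nonneg_left (hx _) (hw i hi).le)
          ⟨a, ha, mul_lt_mul_of_pos_left hlt (hw a ha)⟩
    _ = μ.real {x} := by rw [← Finset.sum_mul, hw1, one_mul]

variable {V : Type*} [MeasurableSpace V] [MeasurableSingletonClass V] {μ : Measure V}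
  [IsFiniteMeasure μ]

theorem finite_setOf_le_measureReal_singleton {c : ℝ} (hc : 0 < c) :
    {x | c ≤ μ.real {x}}.Finite := by
  have h := Measure.finite_const_le_meas_of_disjoint_iUnion μ (ENNReal.ofReal_pos.2 hc)
    (fun x => measurableSet_singleton x)
    (fun x y hxy => by simpa [Function.onFun] using hxy) (measure_ne_top μ _)
  simpa only [ENNReal.ofReal_le_iff_le_toReal (measure_ne_top μ _), ← measureReal_def] using h

theorem exists_forall_measureReal_singleton_le [Nonempty V] :
    ∃ x, ∀ y, μ.real {y} ≤ μ.real {x} := by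
  by_cases! h : ∃ x₀, 0 < μ.real {x₀}
  · obtain ⟨x₀, hx₀⟩ := h
    obtain ⟨x, hx, hmax⟩ := (finite_setOf_le_measureReal_singleton hx₀).exists_maximalFor
      (fun x => μ.real {x}) _ ⟨x₀, le_refl (μ.real {x₀})⟩
    refine ⟨x, fun y => (le_total (μ.real {y}) (μ.real {x})).elim id fun hxy => ?_⟩
    exact hmax (le_trans hx hxy) hxy
  · exact ⟨Classical.arbitrary V, fun y => (h y).trans measureReal_nonneg⟩

theorem nullSingletonClass_of_measureReal_singleton_eq_sum [AddCommGroup V] [IsAddTorsionFree V]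
    {ι : Type*} {A : Finset ι} {w : ι → ℝ} (hw : ∀ a ∈ A, 0 < w a) (hw1 : ∑ a ∈ A, w a = 1)
    {L : V → V} (hL : Function.Injective L) {b : ι → V} (hb : (b '' A).Nontrivial)
    (hμ : ∀ x, μ.real {x} = ∑ a ∈ A, w a * μ.real {L x - b a}) : NullSingletonClass μ := by
  by_contra hatom
  obtain ⟨x₀, hx₀⟩ : ∃ x, μ {x} ≠ 0 := by
    by_contra! h
    exact hatom ⟨h⟩
  have hx₀_pos : 0 < μ.real {x₀} := ENNReal.toReal_pos hx₀ (measure_ne_top μ _)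
  obtain ⟨x, hx⟩ := exists_forall_measureReal_singleton_le (μ := μ)
  have hfin := finite_setOf_le_measureReal_singleton (μ := μ) (hx₀_pos.trans_le (hx x₀))
  have sub_mem {a : ι} (ha : a ∈ A) : ∀ y ∈ hfin.toFinset, L y - b a ∈ hfin.toFinset := by
    intro y hy
    have hxy : μ.real {x} ≤ μ.real {y} := hfin.mem_toFinset.1 hy
    have hy_max := fun z => (hx z).trans hxy
    exact hfin.mem_toFinset.2
      (hxy.trans (measureReal_singleton_le_of_forall_le hw hw1 (hμ y) hy_max ha))
  obtain ⟨-, ⟨i, hi, rfl⟩, -, ⟨j, hj, rfl⟩, hij⟩ := hb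
  have hx_mem : x ∈ hfin.toFinset := hfin.mem_toFinset.2 (le_refl (μ.real {x}))
  exact hij (eq_of_forall_sub_mem hL ⟨x, hx_mem⟩ (sub_mem hi) (sub_mem hj))

end Atoms

section SelfAffine

variable {d : ℕ} {R : Matrix (Fin d) (Fin d) ℤ}

theorem IsExpansive.det_ne_zero (hR : IsExpansive R) : R.det ≠ 0 := by
  have h0 : (0 : ℂ) ∉ spectrum ℂ (R.map (fun k : ℤ => (k : ℂ))) := fun h => by
    have := hR 0 h
    norm_num at this
  have hdet : (R.map (fun k : ℤ => (k : ℂ))).det = R.det := ((Int.castRingHom ℂ).map_det R).symm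
  rw [spectrum.zero_mem_iff, not_not, Matrix.isUnit_iff_isUnit_det, hdet, isUnit_iff_ne_zero] at h0
  exact_mod_cast h0

theorem measurable_tau (a : Fin d → ℤ) : Measurable (tau R a) := by
  have : Continuous (tau R a) := by
    unfold tau
    fun_prop
  exact this.measurable

theorem tau_eq_iff (hR : R.det ≠ 0) (a : Fin d → ℤ) (x y : E d) :
    tau R a y = x ↔ y = WithLp.toLp 2 ((R.map (fun k : ℤ => (k : ℝ))).mulVec x) -
      WithLp.toLp 2 (fun i => (a i : ℝ)) := by
  have hdet : IsUnit (R.map (fun k : ℤ => (k : ℝ))).det := by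
    have : (R.map (fun k : ℤ => (k : ℝ))).det = R.det := ((Int.castRingHom ℝ).map_det R).symm
    rw [this, isUnit_iff_ne_zero]
    exact_mod_cast hR
  have hadd : (fun i => y i + (a i : ℝ)) = (y + WithLp.toLp 2 fun i => (a i : ℝ) : E d).ofLp := rfl
  rw [eq_sub_iff_add_eq, tau, hadd]
  constructor
  · rintro rfl
    rw [Matrix.mulVec_mulVec, Matrix.mul_nonsing_inv _ hdet, Matrix.one_mulVec]
  · intro h
    rw [h, Matrix.mulVec_mulVec, Matrix.nonsing_inv_mul _ hdet, Matrix.one_mulVec]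

theorem IsInvariantMeasure.measureReal_singleton {A : Finset (Fin d → ℤ)} {ρ : (Fin d → ℤ) → ℝ}
    (hρ : ∀ a ∈ A, 0 ≤ ρ a) {μ : Measure (E d)} (hμ : IsInvariantMeasure R A ρ μ) (x : E d) :
    μ.real {x} = ∑ a ∈ A, ρ a * μ.real (tau R a ⁻¹' {x}) := by
  have := hμ.1
  have hx : μ {x} = ∑ a ∈ A, ENNReal.ofReal (ρ a) * μ (tau R a ⁻¹' {x}) := by
    conv_lhs => rw [hμ.2]
    simp only [Measure.finsetSum_apply, Measure.smul_apply, smul_eq_mul,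
      Measure.map_apply (measurable_tau _) (measurableSet_singleton x)]
  rw [measureReal_def, hx, ENNReal.toReal_sum fun a _ =>
    ENNReal.mul_ne_top ENNReal.ofReal_ne_top (measure_ne_top _ _)]
  refine Finset.sum_congr rfl fun a ha => ?_
  rw [ENNReal.toReal_mul, ENNReal.toReal_ofReal (hρ a ha), measureReal_def]

theorem IsInvariantMeasure.nullSingletonClass (hR : R.det ≠ 0) {A : Finset (Fin d → ℤ)}
    (hA : 2 ≤ A.card) {ρ : (Fin d → ℤ) → ℝ} (hρ : ∀ a ∈ A, 0 < ρ a) (hρ1 : ∑ a ∈ A, ρ a = 1)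
    {μ : Measure (E d)} (hμ : IsInvariantMeasure R A ρ μ) : NullSingletonClass μ := by
  have := hμ.1
  let L : E d → E d := fun x => WithLp.toLp 2 ((R.map (fun k : ℤ => (k : ℝ))).mulVec x)
  let b : (Fin d → ℤ) → E d := fun a => WithLp.toLp 2 fun i => (a i : ℝ)
  have hL : Function.Injective L := fun x y h => by
    rw [← (tau_eq_iff hR 0 x _).2 rfl, ← (tau_eq_iff hR 0 y _).2 rfl]
    exact congrArg (fun z => tau R 0 (z - b 0)) h
  have hb : Function.Injective b := fun a a' h => by
    ext i
    have : (a i : ℝ) = a' i := congrArg (fun v : E d => v i) h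
    exact_mod_cast this
  have hA' : (b '' A).Nontrivial := (Finset.one_lt_card_iff_nontrivial.1 hA).image hb
  have : IsAddTorsionFree (E d) := .of_isTorsionFree ℝ (E d)
  refine nullSingletonClass_of_measureReal_singleton_eq_sum hρ hρ1 hL hA' fun x => ?_
  have hpre (a : Fin d → ℤ) : tau R a ⁻¹' {x} = {L x - b a} := Set.ext (tau_eq_iff hR a x)
  simp only [hμ.measureReal_singleton (fun a ha => (hρ a ha).le) x, hpre]

end SelfAffine

section Wiener

open Filter Topology ProbabilityTheory

theorem exists_seq_forall_lt_of_finset {α : Type*} {r : ℕ → α → α → Prop}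
    (h : ∀ n (s : Finset α), ∃ y, ∀ x ∈ s, r n x y) :
    ∃ u : ℕ → α, ∀ m n, m < n → r n (u m) (u n) := by
  classical
  choose next hnext using h
  let u : ℕ → α := Nat.strongRec fun n ih => next n (Finset.univ.image fun m : Fin n => ih m m.2)
  refine ⟨u, fun m n hmn => ?_⟩
  have hu : u n = next n (Finset.univ.image fun m : Fin n => u m) := Nat.strongRec_eq _ _
  rw [hu]
  exact hnext n _ _ (Finset.mem_image_of_mem _ (Finset.mem_univ (⟨m, hmn⟩ : Fin n)))

theorem conv_map_neg_singleton_zero {V : Type*} [AddCommGroup V] [MeasurableSpace V]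
    [MeasurableSingletonClass V] [MeasurableAdd₂ V] [MeasurableNeg V] (μ : Measure V)
    [IsFiniteMeasure μ] [NullSingletonClass μ] : (μ ∗ μ.map Neg.neg) {0} = 0 := by
  have hm : MeasurableSet ((fun p : V × V => p.1 + p.2) ⁻¹' {0}) :=
    measurable_add (measurableSet_singleton 0)
  rw [Measure.conv, Measure.map_apply measurable_add (measurableSet_singleton 0),
    Measure.measure_prod_null hm]
  refine Eventually.of_forall fun x => ?_
  have : Prod.mk x ⁻¹' ((fun p : V × V => p.1 + p.2) ⁻¹' {0}) = {-x} := by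
    ext y
    simp [add_eq_zero_iff_neg_eq, eq_comm]
  change μ.map Neg.neg (Prod.mk x ⁻¹' _) = 0
  rw [this, Measure.map_apply measurable_neg (measurableSet_singleton _)]
  simp

variable {V : Type*} [NormedAddCommGroup V] [InnerProductSpace ℝ V] [MeasurableSpace V]
  [BorelSpace V]

section SecondCountable

variable [SecondCountableTopology V]

theorem integral_charFun_swap (σ γ : Measure V) [IsFiniteMeasure σ] [IsFiniteMeasure γ] :
    ∫ t, charFun σ t ∂γ = ∫ x, charFun γ x ∂σ := by
  simp only [charFun_apply]
  rw [integral_integral_swap]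
  · simp_rw [real_inner_comm]
  · refine Integrable.of_bound (C := 1) (by fun_prop) (Eventually.of_forall fun z => ?_)
    simp [Function.uncurry, Complex.norm_exp_ofReal_mul_I]

theorem charFun_conv_map_neg (μ : Measure V) [IsFiniteMeasure μ] (t : V) :
    charFun (μ ∗ μ.map Neg.neg) t = ((‖charFun μ t‖ ^ 2 : ℝ) : ℂ) := by
  have h : charFun (μ.map Neg.neg) t = charFun μ (-t) := by
    simpa using charFun_map_smul (μ := μ) (-1) t
  rw [charFun_conv, h, charFun_neg, Complex.mul_conj, Complex.normSq_eq_norm_sq]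

theorem tendsto_integral_charFun_zero (σ : Measure V) [IsFiniteMeasure σ] (hσ : σ {0} = 0)
    (γ : ℕ → Measure V) [∀ n, IsProbabilityMeasure (γ n)]
    (hγ : ∀ x ≠ 0, Tendsto (fun n => charFun (γ n) x) atTop (𝓝 0)) :
    Tendsto (fun n => ∫ t, charFun σ t ∂γ n) atTop (𝓝 0) := by
  simp_rw [integral_charFun_swap]
  rw [← integral_zero V ℂ (μ := σ)]
  refine tendsto_integral_of_dominated_convergence (fun _ => 1)
    (fun n => stronglyMeasurable_charFun.aestronglyMeasurable) (integrable_const _)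
    (fun n => Eventually.of_forall fun x => norm_charFun_le_one x) ?_
  have hne : ∀ᵐ x ∂σ, x ≠ 0 := by
    rw [ae_iff]
    simpa using hσ
  filter_upwards [hne] with x hx using hγ x hx

theorem tendsto_integral_norm_charFun_sub_sq_zero (μ : Measure V) [IsFiniteMeasure μ]
    [NullSingletonClass μ] (γ : ℕ → Measure V) [∀ n, IsProbabilityMeasure (γ n)]
    (hγ : ∀ x ≠ 0, Tendsto (fun n => charFun (γ n) x) atTop (𝓝 0)) (s : V) :
    Tendsto (fun n => ∫ t, ‖charFun μ (t - s)‖ ^ 2 ∂γ n) atTop (𝓝 0) := by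
  have hprob (n : ℕ) : IsProbabilityMeasure ((γ n).map (· + -s)) :=
    Measure.isProbabilityMeasure_map (by fun_prop)
  have hchar : ∀ x ≠ 0, Tendsto (fun n => charFun ((γ n).map (· + -s)) x) atTop (𝓝 0) := by
    intro x hx
    simp_rw [charFun_map_add_const]
    simpa only [zero_mul] using (hγ x hx).mul_const _
  have h := tendsto_integral_charFun_zero _ (conv_map_neg_singleton_zero μ) _ hchar
  simp_rw [charFun_conv_map_neg, integral_complex_ofReal] at h
  refine (tendsto_ofReal_iff.1 h).congr fun n => ?_
  have hmeas : Measurable fun t => ‖charFun μ t‖ ^ 2 := measurable_charFun.norm.pow_const 2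
  simp_rw [integral_map (measurable_add_const (-s)).aemeasurable hmeas.aestronglyMeasurable,
    sub_eq_add_neg]

end SecondCountable

variable [FiniteDimensional ℝ V]

theorem tendsto_charFun_stdGaussian_map_smul {x : V} (hx : x ≠ 0) :
    Tendsto (fun n : ℕ => charFun ((stdGaussian V).map ((n : ℝ) • ·)) x) atTop (𝓝 0) := by
  rw [tendsto_zero_iff_norm_tendsto_zero]
  have h (n : ℕ) : ‖charFun ((stdGaussian V).map ((n : ℝ) • ·)) x‖ =
      Real.exp (-(‖x‖ ^ 2 / 2) * (n : ℝ) ^ 2) := by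
    have hre : -((((n : ℝ) * ‖x‖ : ℝ) : ℂ)) ^ 2 / 2 =
      ((-(‖x‖ ^ 2 / 2) * (n : ℝ) ^ 2 : ℝ) : ℂ) := by
      push_cast
      ring
    rw [charFun_map_smul, charFun_stdGaussian, norm_smul, Real.norm_natCast, hre,
      Complex.norm_exp, Complex.ofReal_re]
  simp_rw [h]
  have hx' : -(‖x‖ ^ 2 / 2) < 0 := neg_lt_zero.2 (by positivity)
  exact Real.tendsto_exp_atBot.comp
    ((tendsto_pow_atTop two_ne_zero |>.comp tendsto_natCast_atTop_atTop).const_mul_atTop_of_neg hx')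

theorem exists_forall_norm_charFun_sub_lt (μ : Measure V) [IsFiniteMeasure μ]
    [NullSingletonClass μ] (S : Finset V) {ε : ℝ} (hε : 0 < ε) :
    ∃ t, ∀ s ∈ S, ‖charFun μ (t - s)‖ < ε := by
  let γ (n : ℕ) : Measure V := (stdGaussian V).map ((n : ℝ) • ·)
  have hprob (n : ℕ) : IsProbabilityMeasure (γ n) :=
    Measure.isProbabilityMeasure_map (by fun_prop)
  have hint (s : V) (n : ℕ) : Integrable (fun t => ‖charFun μ (t - s)‖ ^ 2) (γ n) := by
    have hmeas : Measurable fun t => ‖charFun μ (t - s)‖ ^ 2 :=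
      (measurable_charFun.comp (measurable_sub_const s)).norm.pow_const 2
    refine Integrable.of_bound (C := μ.real Set.univ ^ 2) hmeas.aestronglyMeasurable
      (Eventually.of_forall fun t => ?_)
    rw [norm_pow, norm_norm]
    gcongr
    exact norm_charFun_le _
  have hsum : Tendsto (fun n => ∫ t, ∑ s ∈ S, ‖charFun μ (t - s)‖ ^ 2 ∂γ n) atTop (𝓝 0) := by
    simp_rw [integral_finsetSum S fun s _ => hint s _]
    simpa only [Finset.sum_const_zero] using tendsto_finsetSum S fun s _ =>
      tendsto_integral_norm_charFun_sub_sq_zero μ γ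
        (fun x hx => tendsto_charFun_stdGaussian_map_smul hx) s
  obtain ⟨n, hn⟩ := (hsum.eventually (gt_mem_nhds (pow_pos hε 2))).exists
  by_contra! hcon
  refine hn.not_ge ?_
  calc ε ^ 2 = ∫ _, ε ^ 2 ∂γ n := by simp
    _ ≤ ∫ t, ∑ s ∈ S, ‖charFun μ (t - s)‖ ^ 2 ∂γ n := by
      refine integral_mono (integrable_const _) (integrable_finsetSum _ fun s _ => hint s n)
        fun t => ?_
      obtain ⟨s, hs, hle⟩ := hcon t
      exact (pow_le_pow_left₀ hε.le hle 2).trans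
        (Finset.single_le_sum (f := fun s => ‖charFun μ (t - s)‖ ^ 2) (fun _ _ => sq_nonneg _) hs)

theorem exists_seq_norm_charFun_sub_le (μ : Measure V) [IsFiniteMeasure μ]
    [NullSingletonClass μ] {ε : ℕ → ℝ} (hε : ∀ n, 0 < ε n) (hanti : Antitone ε) :
    ∃ u : ℕ → V, ∀ m n, m ≠ n → ‖charFun μ (u n - u m)‖ ≤ ε m * ε n := by
  obtain ⟨u, hu⟩ := exists_seq_forall_lt_of_finset fun n S =>
    exists_forall_norm_charFun_sub_lt μ S (pow_pos (hε n) 2)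
  have hlt (m n : ℕ) (hmn : m < n) : ‖charFun μ (u n - u m)‖ ≤ ε m * ε n :=
    calc ‖charFun μ (u n - u m)‖ ≤ ε n ^ 2 := (hu m n hmn).le
      _ = ε n * ε n := sq _
      _ ≤ ε m * ε n := mul_le_mul_of_nonneg_right (hanti hmn.le) (hε n).le
  refine ⟨u, fun m n hmn => hmn.lt_or_gt.elim (hlt m n) fun hnm => ?_⟩
  rw [← neg_sub, charFun_neg, RCLike.norm_conj, mul_comm]
  exact hlt n m hnm

end Wiener

section AlmostOrthogonal

variable {𝕜 H ι : Type*} [RCLike 𝕜] [NormedAddCommGroup H] [InnerProductSpace 𝕜 H] {v : ι → H}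

theorem norm_sum_smul_sq_le_of_norm_inner_le {ε : ι → ℝ} (hv : ∀ i, ‖v i‖ ≤ 1)
    (hε : ∀ i j, i ≠ j → ‖inner 𝕜 (v i) (v j)‖ ≤ ε i * ε j) (s : Finset ι) (c : ι → 𝕜) :
    ‖∑ i ∈ s, c i • v i‖ ^ 2 ≤ (1 + ∑ i ∈ s, ε i ^ 2) * ∑ i ∈ s, ‖c i‖ ^ 2 := by
  classical
  have hgram (i j : ι) : ‖inner 𝕜 (v i) (v j)‖ ≤ (if i = j then 1 else 0) + ε i * ε j := by
    split_ifs with hij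
    · subst hij
      calc ‖inner 𝕜 (v i) (v i)‖ ≤ ‖v i‖ * ‖v i‖ := norm_inner_le_norm _ _
        _ ≤ 1 := mul_le_one₀ (hv i) (norm_nonneg _) (hv i)
        _ ≤ 1 + ε i * ε i := le_add_of_nonneg_right (mul_self_nonneg _)
    · simpa only [zero_add] using hε i j hij
  calc ‖∑ i ∈ s, c i • v i‖ ^ 2
      = ‖inner 𝕜 (∑ i ∈ s, c i • v i) (∑ j ∈ s, c j • v j)‖ := by
        rw [inner_self_eq_norm_sq_to_K, norm_pow, RCLike.norm_ofReal, abs_norm]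
    _ ≤ ∑ i ∈ s, ∑ j ∈ s, ‖inner 𝕜 (c i • v i) (c j • v j)‖ := by
        rw [sum_inner]
        simp_rw [inner_sum]
        exact (norm_sum_le _ _).trans (Finset.sum_le_sum fun i _ => norm_sum_le _ _)
    _ ≤ ∑ i ∈ s, ∑ j ∈ s, ‖c i‖ * ‖c j‖ * ((if i = j then 1 else 0) + ε i * ε j) := by
        simp_rw [inner_smul_left, inner_smul_right, norm_mul, RCLike.norm_conj, ← mul_assoc]
        gcongr with i _ j _
        exact hgram i j
    _ = ∑ i ∈ s, ‖c i‖ ^ 2 + (∑ i ∈ s, ε i * ‖c i‖) ^ 2 := by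
        simp only [mul_add, Finset.sum_add_distrib, mul_ite, mul_one, mul_zero, Finset.sum_ite_eq]
        rw [sq (∑ i ∈ s, ε i * ‖c i‖), Finset.sum_mul_sum]
        congr 1
        · exact Finset.sum_congr rfl fun i hi => by rw [if_pos hi, sq]
        · exact Finset.sum_congr rfl fun i _ => Finset.sum_congr rfl fun j _ => by ring
    _ ≤ ∑ i ∈ s, ‖c i‖ ^ 2 + (∑ i ∈ s, ε i ^ 2) * ∑ i ∈ s, ‖c i‖ ^ 2 := by
        gcongr
        exact Finset.sum_mul_sq_le_sq_mul_sq s ε fun i => ‖c i‖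
    _ = (1 + ∑ i ∈ s, ε i ^ 2) * ∑ i ∈ s, ‖c i‖ ^ 2 := by ring

theorem sum_norm_inner_sq_le_of_norm_sum_smul_sq_le {s : Finset ι} {C : ℝ} (hC : 0 ≤ C)
    (hv : ∀ c : ι → 𝕜, ‖∑ i ∈ s, c i • v i‖ ^ 2 ≤ C * ∑ i ∈ s, ‖c i‖ ^ 2) (f : H) :
    ∑ i ∈ s, ‖inner 𝕜 (v i) f‖ ^ 2 ≤ C * ‖f‖ ^ 2 := by
  set S := ∑ i ∈ s, ‖inner 𝕜 (v i) f‖ ^ 2 with hS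
  have hS_nonneg : 0 ≤ S := Finset.sum_nonneg fun i _ => sq_nonneg _
  have hinner : inner 𝕜 (∑ i ∈ s, inner 𝕜 (v i) f • v i) f = (S : 𝕜) := by
    rw [sum_inner, hS, RCLike.ofReal_sum]
    refine Finset.sum_congr rfl fun i _ => ?_
    rw [inner_smul_left, RCLike.conj_mul, RCLike.ofReal_pow]
  have hsq : S ^ 2 ≤ (C * ‖f‖ ^ 2) * S :=
    calc S ^ 2 = ‖inner 𝕜 (∑ i ∈ s, inner 𝕜 (v i) f • v i) f‖ ^ 2 := by
          rw [hinner, RCLike.norm_ofReal, sq_abs]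
      _ ≤ ‖∑ i ∈ s, inner 𝕜 (v i) f • v i‖ ^ 2 * ‖f‖ ^ 2 := by
          rw [← mul_pow]
          gcongr
          exact norm_inner_le_norm _ _
      _ ≤ (C * S) * ‖f‖ ^ 2 := by
          gcongr
          exact hv _
      _ = (C * ‖f‖ ^ 2) * S := by ring
  rcases hS_nonneg.eq_or_lt with h | h
  · rw [← h]
    positivity
  · exact le_of_mul_le_mul_right (sq S ▸ hsq) h

end AlmostOrthogonal

section PhasePow

/-- The power `‖w‖ ^ s` with the phase of `w`, extended by `0` at `w = 0`. These powers of the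
values of a function form the analytic family to which the three lines theorem is applied. -/
noncomputable def phasePow (s w : ℂ) : ℂ := (‖w‖ : ℂ) ^ (s - 1) * w

theorem phasePow_one (w : ℂ) : phasePow 1 w = w := by
  simp [phasePow]

theorem norm_phasePow {s : ℂ} (hs : s.re ≠ 0) (w : ℂ) : ‖phasePow s w‖ = ‖w‖ ^ s.re := by
  rcases eq_or_ne w 0 with rfl | hw
  · simp [phasePow, Real.zero_rpow hs]
  · have hw' : 0 < ‖w‖ := norm_pos_iff.2 hw
    rw [phasePow, norm_mul, Complex.norm_cpow_eq_rpow_re_of_pos hw', Complex.sub_re,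
      Complex.one_re, ← Real.rpow_add_one hw'.ne', sub_add_cancel]

theorem norm_phasePow_le {s : ℂ} {r : ℝ} (hs : 0 < s.re) (hr : s.re ≤ r) (w : ℂ) :
    ‖phasePow s w‖ ≤ (1 + ‖w‖) ^ r :=
  calc ‖phasePow s w‖ = ‖w‖ ^ s.re := norm_phasePow hs.ne' w
    _ ≤ (1 + ‖w‖) ^ s.re := Real.rpow_le_rpow (norm_nonneg w) (by linarith) hs.le
    _ ≤ (1 + ‖w‖) ^ r := Real.rpow_le_rpow_of_exponent_le (by linarith [norm_nonneg w]) hr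

theorem differentiable_phasePow (w : ℂ) : Differentiable ℂ fun s => phasePow s w := by
  unfold phasePow
  rcases eq_or_ne w 0 with rfl | hw
  · simp
  · have hw' : (‖w‖ : ℂ) ≠ 0 := by simpa using hw
    exact ((differentiable_id.sub_const 1).const_cpow (Or.inl hw')).mul_const w

end PhasePow

section BesselSystem

theorem two_le_of_holderConjugate_of_le_two {p q : ℝ} (hpq : p.HolderConjugate q) (hp2 : p ≤ 2) :
    2 ≤ q := by
  rw [← inv_le_inv₀ hpq.symm.pos two_pos, ← hpq.one_sub_inv]
  linarith [inv_anti₀ hpq.pos hp2]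

open Complex.HadamardThreeLines
open scoped NNReal

variable {α ι : Type*} [MeasurableSpace α] {μ : Measure α}

/-- A family of functions bounded by `M` which is a Bessel sequence in `L²(μ)` with bound `C`: the
two endpoint hypotheses of the interpolation theorem of F. Riesz. The pairing `∫ f φ i ∂μ` is
bilinear, so that for `φ i = e_{-t}` it is the Fourier transform of `f dμ` at `t`. -/
structure IsBoundedBesselSystem (μ : Measure α) (φ : ι → α → ℂ) (M C : ℝ≥0) : Prop where
  aestronglyMeasurable : ∀ i, AEStronglyMeasurable (φ i) μ
  norm_le : ∀ i x, ‖φ i x‖ ≤ M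
  sum_norm_integral_sq_le : ∀ f : α → ℂ, MemLp f 2 μ → ∀ s : Finset ι,
    ∑ i ∈ s, ‖∫ x, f x * φ i x ∂μ‖ ^ 2 ≤ C * ∫ x, ‖f x‖ ^ 2 ∂μ

theorem integral_simpleFunc_comp_mul (f : SimpleFunc α ℂ) (g : ℂ → ℂ) {φ : α → ℂ}
    (hφ : Integrable φ μ) :
    ∫ x, g (f x) * φ x ∂μ = ∑ c ∈ f.range, g c * ∫ x in f ⁻¹' {c}, φ x ∂μ := by
  have hpoint (x : α) : g (f x) * φ x =
      ∑ c ∈ f.range, (f ⁻¹' {c}).indicator (fun x => g c * φ x) x := by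
    rw [Finset.sum_eq_single_of_mem (f x) (f.mem_range_self x)]
    · rw [Set.indicator_of_mem (show x ∈ f ⁻¹' {f x} from rfl)]
    · exact fun c _ hc => Set.indicator_of_notMem (s := f ⁻¹' {c}) hc.symm _
  simp_rw [hpoint]
  rw [integral_finsetSum _ fun c _ => (hφ.const_mul _).indicator (f.measurableSet_fiber c)]
  simp_rw [integral_indicator (f.measurableSet_fiber _), integral_const_mul]

namespace IsBoundedBesselSystem

variable {φ : ι → α → ℂ} {M C : ℝ≥0}

theorem norm_sum_mul_integral_le (h : IsBoundedBesselSystem μ φ M C) {f : α → ℂ}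
    (hf : Integrable f μ) (b : ι → ℂ) (s : Finset ι) :
    ‖∑ i ∈ s, b i * ∫ x, f x * φ i x ∂μ‖ ≤ M * ((∫ x, ‖f x‖ ∂μ) * ∑ i ∈ s, ‖b i‖) := by
  have hpair (i : ι) : ‖∫ x, f x * φ i x ∂μ‖ ≤ (∫ x, ‖f x‖ ∂μ) * M := by
    rw [← integral_mul_const]
    refine norm_integral_le_of_norm_le (hf.norm.mul_const _) (.of_forall fun x => ?_)
    rw [norm_mul]
    exact mul_le_mul_of_nonneg_left (h.norm_le i x) (norm_nonneg _)
  calc ‖∑ i ∈ s, b i * ∫ x, f x * φ i x ∂μ‖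
      ≤ ∑ i ∈ s, ‖b i‖ * ‖∫ x, f x * φ i x ∂μ‖ := by
        simpa only [norm_mul] using norm_sum_le s fun i => b i * ∫ x, f x * φ i x ∂μ
    _ ≤ ∑ i ∈ s, ‖b i‖ * ((∫ x, ‖f x‖ ∂μ) * M) := by
        gcongr with i
        exact hpair i
    _ = M * ((∫ x, ‖f x‖ ∂μ) * ∑ i ∈ s, ‖b i‖) := by
        rw [← Finset.sum_mul]
        ring

theorem norm_sum_mul_integral_le_sqrt (h : IsBoundedBesselSystem μ φ M C) {f : α → ℂ}
    (hf : MemLp f 2 μ) (b : ι → ℂ) (s : Finset ι) :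
    ‖∑ i ∈ s, b i * ∫ x, f x * φ i x ∂μ‖ ≤
      √(C * ((∫ x, ‖f x‖ ^ 2 ∂μ) * ∑ i ∈ s, ‖b i‖ ^ 2)) := by
  refine Real.le_sqrt_of_sq_le ?_
  calc ‖∑ i ∈ s, b i * ∫ x, f x * φ i x ∂μ‖ ^ 2
      ≤ (∑ i ∈ s, ‖b i‖ * ‖∫ x, f x * φ i x ∂μ‖) ^ 2 := by
        gcongr
        simpa only [norm_mul] using norm_sum_le s fun i => b i * ∫ x, f x * φ i x ∂μ
    _ ≤ (∑ i ∈ s, ‖b i‖ ^ 2) * ∑ i ∈ s, ‖∫ x, f x * φ i x ∂μ‖ ^ 2 :=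
        Finset.sum_mul_sq_le_sq_mul_sq _ _ _
    _ ≤ (∑ i ∈ s, ‖b i‖ ^ 2) * (C * ∫ x, ‖f x‖ ^ 2 ∂μ) := by
        gcongr
        exact h.sum_norm_integral_sq_le f hf s
    _ = C * ((∫ x, ‖f x‖ ^ 2 ∂μ) * ∑ i ∈ s, ‖b i‖ ^ 2) := by ring

variable [IsFiniteMeasure μ]

theorem integrable (h : IsBoundedBesselSystem μ φ M C) (i : ι) : Integrable (φ i) μ :=
  .of_bound (h.aestronglyMeasurable i) M (.of_forall (h.norm_le i))

/-- The analytic family interpolating between the two endpoint estimates; the exponent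
`p * (1 - z / 2)` has real part `p` on the line `re z = 0` and `p / 2` on the line `re z = 1`. -/
noncomputable def interpolant (μ : Measure α) (φ : ι → α → ℂ) (p : ℝ) (f : α → ℂ) (b : ι → ℂ)
    (s : Finset ι) (z : ℂ) : ℂ :=
  ∑ i ∈ s, phasePow (p * (1 - z / 2)) (b i) * ∫ x, phasePow (p * (1 - z / 2)) (f x) * φ i x ∂μ

theorem re_interpolant_exponent (p : ℝ) (z : ℂ) :
    ((p : ℂ) * (1 - z / 2)).re = p * (1 - z.re / 2) := by
  simp

theorem differentiable_interpolant (h : IsBoundedBesselSystem μ φ M C) (p : ℝ)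
    (f : SimpleFunc α ℂ) (b : ι → ℂ) (s : Finset ι) :
    Differentiable ℂ (interpolant μ φ p f b s) := by
  have hpow (w : ℂ) : Differentiable ℂ fun z : ℂ => phasePow (p * (1 - z / 2)) w :=
    (differentiable_phasePow w).comp (by fun_prop)
  unfold interpolant
  simp_rw [integral_simpleFunc_comp_mul f _ (h.integrable _)]
  fun_prop

theorem bddAbove_norm_interpolant (h : IsBoundedBesselSystem μ φ M C) {p : ℝ} (hp : 0 < p)
    (f : SimpleFunc α ℂ) (b : ι → ℂ) (s : Finset ι) :
    BddAbove ((norm ∘ interpolant μ φ p f b s) '' verticalClosedStrip 0 1) := by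
  refine ⟨M * ((∫ x, (1 + ‖f x‖) ^ p ∂μ) * ∑ i ∈ s, (1 + ‖b i‖) ^ p), ?_⟩
  rintro - ⟨z, ⟨hz0, hz1⟩, rfl⟩
  have hpow (w : ℂ) : ‖phasePow (p * (1 - z / 2)) w‖ ≤ (1 + ‖w‖) ^ p := by
    refine norm_phasePow_le ?_ ?_ w <;> rw [re_interpolant_exponent]
    · exact mul_pos hp (by linarith)
    · exact mul_le_of_le_one_right hp.le (by linarith)
  have hint := (f.map (phasePow (p * (1 - z / 2)))).integrable_of_isFiniteMeasure (μ := μ)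
  have hint' := (f.map fun w => (1 + ‖w‖) ^ p).integrable_of_isFiniteMeasure (μ := μ)
  refine (h.norm_sum_mul_integral_le hint _ s).trans
    (mul_le_mul_of_nonneg_left (mul_le_mul ?_ ?_ ?_ ?_) M.coe_nonneg)
  · exact integral_mono hint.norm hint' fun x => hpow (f x)
  · exact Finset.sum_le_sum fun i _ => hpow (b i)
  · exact Finset.sum_nonneg fun i _ => norm_nonneg _
  · exact integral_nonneg fun x => Real.rpow_nonneg (by positivity) p

theorem norm_interpolant_le_of_re_eq_zero (h : IsBoundedBesselSystem μ φ M C) {p : ℝ} (hp : 0 < p)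
    (f : SimpleFunc α ℂ) (b : ι → ℂ) (s : Finset ι) {z : ℂ} (hz : z.re = 0) :
    ‖interpolant μ φ p f b s z‖ ≤ M * ((∫ x, ‖f x‖ ^ p ∂μ) * ∑ i ∈ s, ‖b i‖ ^ p) := by
  have hre : ((p : ℂ) * (1 - z / 2)).re = p := by
    rw [re_interpolant_exponent, hz, zero_div, sub_zero, mul_one]
  have hpow (w : ℂ) : ‖phasePow (p * (1 - z / 2)) w‖ = ‖w‖ ^ p := by
    rw [norm_phasePow (by rw [hre]; exact hp.ne'), hre]
  have hint := (f.map (phasePow (p * (1 - z / 2)))).integrable_of_isFiniteMeasure (μ := μ)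
  simpa only [interpolant, SimpleFunc.map_apply, hpow] using h.norm_sum_mul_integral_le hint
    (fun i => phasePow (p * (1 - z / 2)) (b i)) s

theorem norm_interpolant_le_of_re_eq_one (h : IsBoundedBesselSystem μ φ M C) {p : ℝ} (hp : 0 < p)
    (f : SimpleFunc α ℂ) (b : ι → ℂ) (s : Finset ι) {z : ℂ} (hz : z.re = 1) :
    ‖interpolant μ φ p f b s z‖ ≤ √(C * ((∫ x, ‖f x‖ ^ p ∂μ) * ∑ i ∈ s, ‖b i‖ ^ p)) := by
  have hre : ((p : ℂ) * (1 - z / 2)).re = p / 2 := by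
    rw [re_interpolant_exponent, hz]
    ring
  have hpow (w : ℂ) : ‖phasePow (p * (1 - z / 2)) w‖ ^ 2 = ‖w‖ ^ p := by
    rw [norm_phasePow (by rw [hre]; exact (half_pos hp).ne'), hre,
      ← Real.rpow_mul_natCast (norm_nonneg w)]
    norm_num
  have hmem := (f.map (phasePow (p * (1 - z / 2)))).memLp_of_isFiniteMeasure 2 μ
  simpa only [interpolant, SimpleFunc.map_apply, hpow] using h.norm_sum_mul_integral_le_sqrt hmem
    (fun i => phasePow (p * (1 - z / 2)) (b i)) s

theorem norm_sum_mul_integral_simpleFunc_le (h : IsBoundedBesselSystem μ φ M C) {p q : ℝ}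
    (hpq : p.HolderConjugate q) (hp2 : p ≤ 2) (f : SimpleFunc α ℂ) (b : ι → ℂ) (s : Finset ι) :
    ‖∑ i ∈ s, b i * ∫ x, f x * φ i x ∂μ‖ ≤ M ^ (1 - 2 / q) * C ^ q⁻¹ *
      ((∫ x, ‖f x‖ ^ p ∂μ) * ∑ i ∈ s, ‖b i‖ ^ p) ^ p⁻¹ := by
  have hq : p⁻¹ = 1 - 2 / q + q⁻¹ := by
    rw [← hpq.symm.one_sub_inv]
    ring
  have hq2 : 2 / q ≤ 1 :=
    (div_le_one hpq.symm.pos).2 (two_le_of_holderConjugate_of_le_two hpq hp2)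
  have hexp : (p : ℂ) * (1 - ((2 / q : ℝ) : ℂ) / 2) = 1 := by
    have hp : p * (1 - 2 / q / 2) = 1 := by
      rw [div_div_cancel_left' two_ne_zero, hpq.symm.one_sub_inv, mul_inv_cancel₀ hpq.ne_zero]
    exact_mod_cast hp
  have hmem : ((2 / q : ℝ) : ℂ) ∈ verticalClosedStrip 0 1 :=
    ⟨div_nonneg zero_le_two hpq.symm.nonneg, hq2⟩
  have hinterp := norm_le_interp_of_mem_verticalClosedStrip₀₁' (interpolant μ φ p f b s) hmem
    (h.differentiable_interpolant p f b s).diffContOnCl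
    (h.bddAbove_norm_interpolant hpq.pos f b s)
    (fun z hz => h.norm_interpolant_le_of_re_eq_zero hpq.pos f b s hz)
    (fun z hz => h.norm_interpolant_le_of_re_eq_one hpq.pos f b s hz)
  simp only [interpolant, hexp, phasePow_one, Complex.ofReal_re] at hinterp
  refine hinterp.trans_eq ?_
  set X := (∫ x, ‖f x‖ ^ p ∂μ) * ∑ i ∈ s, ‖b i‖ ^ p
  have hX : 0 ≤ X := mul_nonneg (integral_nonneg fun x => by positivity)
    (Finset.sum_nonneg fun i _ => by positivity)
  have hsqrt : √(C * X) ^ (2 / q) = C ^ q⁻¹ * X ^ q⁻¹ := by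
    rw [Real.sqrt_eq_rpow, ← Real.rpow_mul (mul_nonneg C.coe_nonneg hX),
      Real.mul_rpow C.coe_nonneg hX]
    field_simp
  rw [hsqrt, Real.mul_rpow M.coe_nonneg hX, hq,
    Real.rpow_add_of_nonneg hX (sub_nonneg.2 hq2) hpq.symm.inv_nonneg]
  ring

end IsBoundedBesselSystem

theorem rpow_sum_norm_le_of_forall_norm_sum_mul_le {p q : ℝ} (hpq : p.HolderConjugate q)
    {s : Finset ι} {a : ι → ℂ} {K : ℝ}
    (h : ∀ b : ι → ℂ, ∑ i ∈ s, ‖b i‖ ^ p ≤ 1 → ‖∑ i ∈ s, b i * a i‖ ≤ K) :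
    (∑ i ∈ s, ‖a i‖ ^ q) ^ q⁻¹ ≤ K := by
  obtain ⟨⟨g, hg, hga⟩, -⟩ := NNReal.isGreatest_Lp s (fun i => ‖a i‖₊) hpq.symm
  choose u hu hua using fun i => RCLike.exists_norm_eq_mul_self (a i)
  have hsum : ∑ i ∈ s, g i * u i * a i = ((∑ i ∈ s, ‖a i‖ ^ q) ^ q⁻¹ : ℝ) := by
    have hga' : ∑ i ∈ s, ‖a i‖ * g i = (∑ i ∈ s, ‖a i‖ ^ q) ^ q⁻¹ := by
      rw [← one_div]
      simpa using congrArg NNReal.toReal hga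
    rw [← hga', Complex.ofReal_sum]
    refine Finset.sum_congr rfl fun i _ => ?_
    rw [Complex.ofReal_mul, mul_assoc, ← hua, mul_comm]
    rfl
  refine (le_abs_self _).trans ?_
  rw [← Real.norm_eq_abs, ← Complex.norm_real, ← hsum]
  refine h (fun i => g i * u i) ?_
  simp only [norm_mul, hu, mul_one]
  simpa using NNReal.coe_le_coe.2 hg

theorem continuous_integral_mul {p q : ℝ≥0∞} [Fact (1 ≤ p)] [Fact (1 ≤ q)]
    [ENNReal.HolderConjugate p q] {g : α → ℂ} (hg : MemLp g q μ) :
    Continuous fun F : Lp ℂ p μ => ∫ x, F x * g x ∂μ := by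
  let B := ContinuousLinearMap.mul ℂ ℂ
  refine ((B.lpPairing μ p q).flip (hg.toLp g)).continuous.congr fun F => ?_
  rw [ContinuousLinearMap.flip_apply, ContinuousLinearMap.lpPairing_eq_integral]
  refine integral_congr_ae ?_
  filter_upwards [hg.coeFn_toLp] with x hx
  rw [hx, ContinuousLinearMap.mul_apply']

namespace IsBoundedBesselSystem

variable {φ : ι → α → ℂ} {M C : ℝ≥0} [IsFiniteMeasure μ]

theorem rpow_sum_norm_integral_simpleFunc_le (h : IsBoundedBesselSystem μ φ M C) {p q : ℝ≥0∞}
    (hpq : p.toReal.HolderConjugate q.toReal) (hp2 : p.toReal ≤ 2) (f : SimpleFunc α ℂ)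
    (s : Finset ι) :
    (∑ i ∈ s, ‖∫ x, f x * φ i x ∂μ‖ ^ q.toReal) ^ q.toReal⁻¹ ≤
      M ^ (1 - 2 / q.toReal) * C ^ q.toReal⁻¹ * (eLpNorm f p μ).toReal := by
  have hN : 0 ≤ ∫ x, ‖f x‖ ^ p.toReal ∂μ := integral_nonneg fun x => by positivity
  obtain ⟨hp0, hptop⟩ := ENNReal.toReal_pos_iff.1 hpq.pos
  rw [(f.memLp_of_isFiniteMeasure p μ).eLpNorm_eq_integral_rpow_norm hp0.ne' hptop.ne,
    ENNReal.toReal_ofReal (by positivity)]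
  refine rpow_sum_norm_le_of_forall_norm_sum_mul_le hpq fun b hb =>
    (h.norm_sum_mul_integral_simpleFunc_le hpq hp2 f b s).trans
      (mul_le_mul_of_nonneg_left (Real.rpow_le_rpow ?_ ?_ hpq.inv_nonneg) (by positivity))
  · exact mul_nonneg hN (Finset.sum_nonneg fun i _ => by positivity)
  · exact mul_le_of_le_one_right hN hb

/-- F. Riesz's generalization of the Hausdorff–Young inequality. -/
theorem rpow_sum_norm_integral_le (h : IsBoundedBesselSystem μ φ M C) {p q : ℝ≥0∞}
    (hpq : p.toReal.HolderConjugate q.toReal) (hp2 : p.toReal ≤ 2) {f : α → ℂ} (hf : MemLp f p μ)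
    (s : Finset ι) :
    (∑ i ∈ s, ‖∫ x, f x * φ i x ∂μ‖ ^ q.toReal) ^ q.toReal⁻¹ ≤
      M ^ (1 - 2 / q.toReal) * C ^ q.toReal⁻¹ * (eLpNorm f p μ).toReal := by
  have : ENNReal.HolderConjugate p q := .of_toReal hpq
  have : Fact (1 ≤ p) := ⟨ENNReal.HolderConjugate.one_le p q⟩
  have : Fact (1 ≤ q) := ⟨ENNReal.HolderConjugate.one_le q p⟩
  have hcont (i : ι) : Continuous fun F : Lp ℂ p μ => ∫ x, F x * φ i x ∂μ :=
    continuous_integral_mul (q := q)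
      (.of_bound (h.aestronglyMeasurable i) M (.of_forall (h.norm_le i)))
  have hcongr {f g : α → ℂ} (hfg : f =ᵐ[μ] g) (i : ι) :
      ∫ x, f x * φ i x ∂μ = ∫ x, g x * φ i x ∂μ :=
    integral_congr_ae (hfg.mul (ae_eq_refl _))
  have hLp (F : Lp ℂ p μ) :
      (∑ i ∈ s, ‖∫ x, F x * φ i x ∂μ‖ ^ q.toReal) ^ q.toReal⁻¹ ≤
        M ^ (1 - 2 / q.toReal) * C ^ q.toReal⁻¹ * ‖F‖ := by
    refine (Lp.simpleFunc.denseRange (ENNReal.toReal_pos_iff.1 hpq.pos).2.ne).induction_on F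
      (isClosed_le ?_ (by fun_prop)) fun G => ?_
    · exact (continuous_finsetSum s fun i _ => (hcont i).norm.rpow_const fun _ =>
        .inr hpq.symm.nonneg).rpow_const fun _ => .inr hpq.symm.inv_nonneg
    · have hG := Lp.simpleFunc.toSimpleFunc_eq_toFun G
      simp_rw [Lp.norm_def, ← eLpNorm_congr_ae hG, ← hcongr hG]
      exact h.rpow_sum_norm_integral_simpleFunc_le hpq hp2 _ s
  simpa only [hcongr hf.coeFn_toLp, Lp.norm_toLp] using hLp (hf.toLp f)

theorem tsum_enorm_integral_rpow_le (h : IsBoundedBesselSystem μ φ M C) {p q : ℝ≥0∞}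
    (hpq : p.toReal.HolderConjugate q.toReal) (hp2 : p.toReal ≤ 2) {f : α → ℂ}
    (hf : MemLp f p μ) :
    ∑' i, ‖∫ x, f x * φ i x ∂μ‖ₑ ^ q.toReal ≤
      M ^ (q.toReal - 2) * C * eLpNorm f p μ ^ q.toReal := by
  have hq0 := hpq.symm.pos
  have hq2 : 2 ≤ q.toReal := two_le_of_holderConjugate_of_le_two hpq hp2
  have hM : ((M : ℝ) ^ (1 - 2 / q.toReal)) ^ q.toReal = M ^ (q.toReal - 2) := by
    rw [← Real.rpow_mul M.coe_nonneg, sub_mul, one_mul, div_mul_cancel₀ _ hq0.ne']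
  have hbound : M ^ (q.toReal - 2) * C * eLpNorm f p μ ^ q.toReal = ENNReal.ofReal
      ((M ^ (1 - 2 / q.toReal) * C ^ q.toReal⁻¹ * (eLpNorm f p μ).toReal) ^ q.toReal) := by
    rw [Real.mul_rpow (by positivity) (by positivity),
      Real.mul_rpow (by positivity) (by positivity), hM,
      Real.rpow_inv_rpow C.coe_nonneg hq0.ne', ENNReal.ofReal_mul (by positivity),
      ENNReal.ofReal_mul (by positivity), ← ENNReal.ofReal_rpow_of_nonneg (by positivity) hq0.le,
      ← ENNReal.ofReal_rpow_of_nonneg M.coe_nonneg (sub_nonneg.2 hq2),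
      ENNReal.ofReal_toReal hf.2.ne, ENNReal.ofReal_coe_nnreal, ENNReal.ofReal_coe_nnreal]
  rw [ENNReal.tsum_eq_iSup_sum, hbound]
  refine iSup_le fun s => ?_
  calc ∑ i ∈ s, ‖∫ x, f x * φ i x ∂μ‖ₑ ^ q.toReal
      = ENNReal.ofReal (∑ i ∈ s, ‖∫ x, f x * φ i x ∂μ‖ ^ q.toReal) := by
        rw [ENNReal.ofReal_sum_of_nonneg fun i _ => by positivity]
        refine Finset.sum_congr rfl fun i _ => ?_
        rw [← ofReal_norm, ENNReal.ofReal_rpow_of_nonneg (norm_nonneg _) hq0.le]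
    _ ≤ _ := ENNReal.ofReal_le_ofReal <| (Real.rpow_inv_le_iff_of_pos
        (Finset.sum_nonneg fun i _ => by positivity) (by positivity) hq0).1
          (h.rpow_sum_norm_integral_le hpq hp2 hf s)

end IsBoundedBesselSystem

theorem inner_toLp_toLp {f g : α → ℂ} (hf : MemLp f 2 μ) (hg : MemLp g 2 μ) :
    inner ℂ (hf.toLp f) (hg.toLp g) = ∫ x, g x * starRingEnd ℂ (f x) ∂μ := by
  rw [L2.inner_def]
  refine integral_congr_ae ?_
  filter_upwards [hf.coeFn_toLp, hg.coeFn_toLp] with x hfx hgx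
  rw [hfx, hgx, RCLike.inner_apply]

theorem norm_toLp_two_sq {f : α → ℂ} (hf : MemLp f 2 μ) :
    ‖hf.toLp f‖ ^ 2 = ∫ x, ‖f x‖ ^ 2 ∂μ := by
  have h := inner_toLp_toLp hf hf
  simp_rw [inner_self_eq_norm_sq_to_K, RCLike.mul_conj] at h
  exact_mod_cast h

theorem isBoundedBesselSystem_of_norm_integral_mul_conj_le [IsProbabilityMeasure μ]
    {φ : ι → α → ℂ} {ε : ι → ℝ} {S : ℝ≥0} (hφ : ∀ i, AEStronglyMeasurable (φ i) μ)
    (hφ1 : ∀ i x, ‖φ i x‖ ≤ 1)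
    (hε : ∀ i j, i ≠ j → ‖∫ x, φ i x * starRingEnd ℂ (φ j x) ∂μ‖ ≤ ε i * ε j)
    (hS : ∀ s : Finset ι, ∑ i ∈ s, ε i ^ 2 ≤ S) :
    IsBoundedBesselSystem μ φ 1 (1 + S) where
  aestronglyMeasurable := hφ
  norm_le := hφ1
  sum_norm_integral_sq_le f hf s := by
    have hφL (i : ι) : MemLp (φ i) 2 μ := .of_bound (hφ i) 1 (.of_forall (hφ1 i))
    have hconj (i : ι) : MemLp (fun x => starRingEnd ℂ (φ i x)) 2 μ := (hφL i).star
    let v (i : ι) : Lp ℂ 2 μ := (hconj i).toLp _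
    have hv (i : ι) : ‖v i‖ ≤ 1 := by
      refine (Lp.norm_le_of_ae_bound zero_le_one ?_).trans_eq (by simp [measureUnivNNReal])
      filter_upwards [(hconj i).coeFn_toLp] with x hx
      rw [hx, RCLike.norm_conj]
      exact hφ1 i x
    have hgram (i j : ι) (hij : i ≠ j) : ‖inner ℂ (v i) (v j)‖ ≤ ε i * ε j := by
      simpa only [v, inner_toLp_toLp, Complex.conj_conj, mul_comm] using hε i j hij
    have hbound : ∑ i ∈ s, ‖inner ℂ (v i) (hf.toLp f)‖ ^ 2 ≤ (1 + S) * ‖hf.toLp f‖ ^ 2 :=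
      sum_norm_inner_sq_le_of_norm_sum_smul_sq_le (by positivity)
        (fun c => (norm_sum_smul_sq_le_of_norm_inner_le hv hgram s c).trans <|
          mul_le_mul_of_nonneg_right (by linarith [hS s])
            (Finset.sum_nonneg fun i _ => sq_nonneg _)) _
    simpa only [v, inner_toLp_toLp, Complex.conj_conj, norm_toLp_two_sq, NNReal.coe_add,
      NNReal.coe_one] using hbound

end BesselSystem

section Exponentials

open scoped NNReal

variable {d : ℕ} {μ : Measure (E d)} {p q : ℝ≥0∞}

theorem norm_expo (t x : E d) : ‖expo t x‖ = 1 := by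
  have h : expo t x = Complex.exp (((2 * Real.pi * inner ℝ t x : ℝ) : ℂ) * Complex.I) := by
    rw [expo]
    congr 1
    push_cast
    ring
  rw [h, Complex.norm_exp_ofReal_mul_I]

theorem continuous_expo (t : E d) : Continuous (expo t) := by
  unfold expo
  fun_prop

theorem conj_expo (t x : E d) : starRingEnd ℂ (expo t x) = expo (-t) x := by
  rw [expo, expo, ← Complex.exp_conj]
  congr 1
  simp [Complex.conj_ofNat]

theorem expo_neg_mul_expo (s t x : E d) :
    expo (-s) x * expo t x = Complex.exp (inner ℝ x ((2 * Real.pi) • (t - s)) * Complex.I) := by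
  rw [expo, expo, ← Complex.exp_add]
  congr 1
  rw [inner_smul_right, inner_sub_right, inner_neg_left, real_inner_comm s, real_inner_comm t]
  push_cast
  ring

theorem integral_expo_neg_mul_conj_expo_neg (s t : E d) :
    ∫ x, expo (-s) x * starRingEnd ℂ (expo (-t) x) ∂μ = charFun μ ((2 * Real.pi) • (t - s)) := by
  simp_rw [conj_expo, neg_neg, expo_neg_mul_expo, charFun_apply]

theorem enorm_fourierMeasure_le (f : E d → ℂ) (t : E d) :
    ‖fourierMeasure μ f t‖ₑ ≤ eLpNorm f 1 μ := by
  refine (enorm_integral_le_lintegral_enorm _).trans_eq ?_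
  rw [eLpNorm_one_eq_lintegral_enorm]
  refine lintegral_congr fun x => ?_
  rw [enorm_mul, ← ofReal_norm (expo (-t) x), norm_expo, ENNReal.ofReal_one, mul_one]

variable [IsProbabilityMeasure μ]

theorem eLpNorm_expo (t : E d) (hp : p ≠ 0) : eLpNorm (expo t) p μ = 1 := by
  have hnorm : ∀ᵐ x ∂μ, ‖expo t x‖ = ‖(1 : ℂ)‖ := .of_forall fun x => by rw [norm_expo, norm_one]
  rw [eLpNorm_congr_norm_ae hnorm, eLpNorm_const _ hp (IsProbabilityMeasure.ne_zero μ)]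
  simp

theorem semiInner_expo (f : E d → ℂ) (t : E d) (hp : p ≠ 0) :
    semiInner p μ f (expo t) = fourierMeasure μ f t := by
  have hsgn (x : E d) : sgn (expo t x) = expo t x := by
    have hne : expo t x ≠ 0 := Complex.exp_ne_zero _
    rw [sgn, if_neg hne, norm_expo, Complex.ofReal_one, div_one]
  simp [semiInner, fourierMeasure, eLpNorm_expo t hp, norm_expo, hsgn, conj_expo]

theorem isBesselMeasure_diracSum_range {ι : Type*} {l : ι → E d} (hl : Function.Injective l)
    {C : ℝ≥0} (h : IsBoundedBesselSystem μ (fun i => expo (-l i)) 1 C) (hp2 : p ≤ 2)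
    (hpq : ENNReal.HolderConjugate p q) :
    IsBesselMeasure p q μ (diracSum (Set.range l)) := by
  have hp1 : 1 ≤ p := ENNReal.HolderConjugate.one_le p q
  have hp0 : p ≠ 0 := (zero_lt_one.trans_le hp1).ne'
  rcases eq_or_ne p 1 with rfl | hp1'
  · refine ⟨1, one_pos, fun f _ => ?_⟩
    rw [if_pos rfl, ENNReal.ofReal_one, one_mul, eLpNorm_exponent_top]
    exact essSup_le_of_ae_le _ (.of_forall fun t => enorm_fourierMeasure_le f t)
  have hptop : p ≠ ∞ := (hp2.trans_lt ENNReal.ofNat_lt_top).ne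
  have hp2' : p.toReal ≤ 2 := ENNReal.toReal_mono ENNReal.ofNat_ne_top hp2
  have hpq' : p.toReal.HolderConjugate q.toReal := ENNReal.HolderConjugate.toReal
    ((ENNReal.toReal_lt_toReal ENNReal.one_ne_top hptop).2 (hp1.lt_of_ne' hp1'))
  refine ⟨C + 1, by positivity, fun f hf => ?_⟩
  rw [if_neg hp1', diracSum, lintegral_sum_measure]
  simp_rw [lintegral_dirac, semiInner_expo f _ hp0]
  calc ∑' t : Set.range l, ‖fourierMeasure μ f t‖ₑ ^ q.toReal
      = ∑' i, ‖fourierMeasure μ f (l i)‖ₑ ^ q.toReal :=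
        tsum_range (fun t => ‖fourierMeasure μ f t‖ₑ ^ q.toReal) hl
    _ ≤ C * eLpNorm f p μ ^ q.toReal := by
        simpa [fourierMeasure] using h.tsum_enorm_integral_rpow_le hpq' hp2' hf
    _ ≤ ENNReal.ofReal (C + 1) * eLpNorm f p μ ^ q.toReal := by
        gcongr
        rw [← ENNReal.ofReal_coe_nnreal]
        exact ENNReal.ofReal_le_ofReal (by linarith)

theorem isBoundedBesselSystem_expo {ι : Type*} {l : ι → E d} {ε : ι → ℝ} {S : ℝ≥0}
    (hε : ∀ i j, i ≠ j → ‖charFun μ ((2 * Real.pi) • (l j - l i))‖ ≤ ε i * ε j)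
    (hS : ∀ s : Finset ι, ∑ i ∈ s, ε i ^ 2 ≤ S) :
    IsBoundedBesselSystem μ (fun i => expo (-l i)) 1 (1 + S) :=
  isBoundedBesselSystem_of_norm_integral_mul_conj_le
    (fun i => (continuous_expo (-l i)).aestronglyMeasurable) (fun i x => (norm_expo (-l i) x).le)
    (fun i j hij => by simpa only [integral_expo_neg_mul_conj_expo_neg] using hε i j hij) hS

theorem exists_injective_isBoundedBesselSystem_expo (μ : Measure (E d)) [IsProbabilityMeasure μ]
    [NullSingletonClass μ] :
    ∃ (l : ℕ → E d) (C : ℝ≥0), Function.Injective l ∧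
      IsBoundedBesselSystem μ (fun n => expo (-l n)) 1 C := by
  let ε (n : ℕ) : ℝ := (1 / 2) ^ (n + 1)
  have hε_lt (n : ℕ) : ε n < 1 := pow_lt_one₀ (by norm_num) (by norm_num) n.succ_ne_zero
  obtain ⟨u, hu⟩ := exists_seq_norm_charFun_sub_le μ (ε := ε) (fun n => by positivity)
    fun m n hmn => pow_le_pow_of_le_one (by norm_num) (by norm_num) (by lia)
  let l (n : ℕ) : E d := (2 * Real.pi)⁻¹ • u n
  have hgram (m n : ℕ) (hmn : m ≠ n) :
      ‖charFun μ ((2 * Real.pi) • (l n - l m))‖ ≤ ε m * ε n := by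
    rw [← smul_sub, smul_inv_smul₀ (by positivity)]
    exact hu m n hmn
  refine ⟨l, 1 + 2, fun m n hmn => ?_, isBoundedBesselSystem_expo hgram fun s => ?_⟩
  · by_contra hne
    have hle := hgram m n hne
    rw [hmn, sub_self, smul_zero, charFun_zero, probReal_univ, Complex.ofReal_one, norm_one] at hle
    exact hle.not_gt (mul_lt_one_of_nonneg_of_lt_one_left (by positivity) (hε_lt m) (hε_lt n).le)
  · calc ∑ n ∈ s, ε n ^ 2 ≤ ∑ n ∈ s, (1 / 2) ^ n := by
          gcongr with n
          rw [← pow_mul]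
          exact pow_le_pow_of_le_one (by norm_num) (by norm_num) (by lia)
      _ ≤ 2 := sum_le_hasSum s (fun n _ => by positivity) hasSum_geometric_two

end Exponentials

end PQBessel

theorem mainTheorem4_general {d : ℕ} (μ : Measure (PQBessel.E d)) [IsProbabilityMeasure μ]
    [NullSingletonClass μ] :
    ∃ Λ : Set (PQBessel.E d), Λ.Infinite ∧ Λ.Countable ∧
      ∀ p q : ℝ≥0∞, p ≤ 2 → ENNReal.HolderConjugate p q →
        PQBessel.IsBesselMeasure p q μ (PQBessel.diracSum Λ) := by
  obtain ⟨l, C, hl, hsys⟩ := PQBessel.exists_injective_isBoundedBesselSystem_expo μ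
  exact ⟨Set.range l, Set.infinite_range_of_injective hl, Set.countable_range l,
    fun _ _ hp2 hpq => PQBessel.isBesselMeasure_diracSum_range hl hsys hp2 hpq⟩

theorem mainTheorem4 (d : ℕ) (R : Matrix (Fin d) (Fin d) ℤ) (hR : PQBessel.IsExpansive R)
    (A : Finset (Fin d → ℤ)) (hA0 : (0 : Fin d → ℤ) ∈ A) (hA : 2 ≤ A.card)
    (ρ : (Fin d → ℤ) → ℝ) (hρ : ∀ a ∈ A, 0 < ρ a ∧ ρ a < 1) (hρ1 : ∑ a ∈ A, ρ a = 1)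
    (μ : Measure (PQBessel.E d)) (hμ : PQBessel.IsInvariantMeasure R A ρ μ) :
    ∃ Λ : Set (PQBessel.E d), Λ.Infinite ∧ Λ.Countable ∧
      ∀ p q : ℝ≥0∞, 1 ≤ p → p ≤ 2 → ENNReal.HolderConjugate p q →
        PQBessel.IsBesselMeasure p q μ (PQBessel.diracSum Λ) := by
  have := hμ.1
  have := hμ.nullSingletonClass hR.det_ne_zero hA (fun a ha => (hρ a ha).1) hρ1
  obtain ⟨Λ, hinf, hcount, hΛ⟩ := mainTheorem4_general μ
  exact ⟨Λ, hinf, hcount, fun p q _ => hΛ p q⟩
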